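/- Let $\mathcal H$ be a complex Hilbert space with an orthonormal basis $(e_n)_{n\ge 0}$, and let $S$ be a unilateral weighted shift on $\mathcal H$ with a bounded sequence of positive weights $(\omega_n)_{n\ge 0}$, i.e. the bounded linear operator with $Se_n=\omega_n e_{n+1}$ for all $n\ge 0$. Put $\beta_0=1$ and $\beta_n=\omega_0\cdots\omega_{n-1}$ for $n\ge 1$. For $x\in\mathcal H$, let the local resolvent set $\rho_S(x)$ be the union of all open sets $U\subset\mathbb C$ on which there is an analytic function $f:U\to\mathcal H$ with $(S-\lambda)f(\lambda)=x$ for all $\lambda\in U$, and let $\sigma_S(x)=\mathbb C\setminus\rho_S(x)$ be the local spectrum of $S$ at $x$. Suppose that $S$ satisfies Dunford's condition (C): for every closed set $F\subset\mathbb C$, the linear subspace $\{x\in\mathcal H:\sigma_S(x)\subset F\}$ is closed in $\mathcal H$. Then the spectral radius $r(S)$ of $S$ is $$r(S)=r_3(S):=\limsup_{n\to\infty}\beta_n^{1/n}.$$ -/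

import Mathlib

open Filter

noncomputable section

/-- The local resolvent set of `T` at `x`: the union of all open sets `U` on which there is an
analytic vector-valued function `f` with `(T - z) f(z) = x` for all `z ∈ U`. -/
def localResolventSet {H : Type*} [NormedAddCommGroup H] [InnerProductSpace ℂ H]
    (T : H →L[ℂ] H) (x : H) : Set ℂ :=
  ⋃₀ {U : Set ℂ | IsOpen U ∧
    ∃ f : ℂ → H, AnalyticOnNhd ℂ f U ∧ ∀ z ∈ U, T (f z) - z • f z = x}

/-- The local spectrum of `T` at `x`. -/
def localSpectrum {H : Type*} [NormedAddCommGroup H] [InnerProductSpace ℂ H]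
    (T : H →L[ℂ] H) (x : H) : Set ℂ :=
  (localResolventSet T x)ᶜ

/-- The analytic spectral subspace of `T` associated with `F` (as a set of vectors). -/
def analyticSpectralSubspace {H : Type*} [NormedAddCommGroup H] [InnerProductSpace ℂ H]
    (T : H →L[ℂ] H) (F : Set ℂ) : Set H :=
  {x : H | localSpectrum T x ⊆ F}

/-- Dunford's condition (C): the analytic spectral subspace of every closed set is closed. -/
def DunfordConditionC {H : Type*} [NormedAddCommGroup H] [InnerProductSpace ℂ H]
    (T : H →L[ℂ] H) : Prop :=
  ∀ F : Set ℂ, IsClosed F → IsClosed (analyticSpectralSubspace T F)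

/-- `S` is the unilateral weighted shift with positive weights `ω` with respect to the
orthonormal basis `e`. Boundedness of `ω` is automatic, because `S` is a bounded operator
and `‖S (e n)‖ = ω n`. -/
structure IsUnilateralWeightedShift {H : Type*} [NormedAddCommGroup H] [InnerProductSpace ℂ H]
    (e : HilbertBasis ℕ ℂ H) (ω : ℕ → ℝ) (S : H →L[ℂ] H) : Prop where
  weight_pos : ∀ n, 0 < ω n
  apply_basis : ∀ n, S (e n) = (ω n : ℂ) • e (n + 1)

/-- `β₀ = 1` and `βₙ = ω₀ ⋯ ωₙ₋₁`. -/
def weightProd (ω : ℕ → ℝ) (n : ℕ) : ℝ := ∏ i ∈ Finset.range n, ω i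

/-- `r₃ = limsup βₙ^(1/n)`, taken in `[0, ∞]`, like Mathlib's spectral radius. -/
def shiftR3 (ω : ℕ → ℝ) : ENNReal :=
  limsup (fun n : ℕ => ENNReal.ofReal (weightProd ω n ^ (1 / (n : ℝ)))) atTop

end

/-! Since `‖Sⁿ e₀‖ = βₙ`, the Neumann series `-∑ z⁻ⁿ⁻¹ Sⁿ e₀` converges for `|z| > r₃`, so `e₀` has
local spectrum in the disc `|z| ≤ r₃`. Solvability on a fixed open set is linear and passes from `x`
to `S x`, hence holds for every `eₙ` and on their dense span. Condition (C) extends the inclusion to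
all vectors, so `S - z` is onto for `|z| > r₃`. It is also injective, as a shift has no nonzero
eigenvalue; thus `r(S) ≤ r₃`. The converse is `βₙ ≤ ‖Sⁿ‖` with Gelfand's formula. -/

section LocalResolvent

variable {H : Type*} [NormedAddCommGroup H] [InnerProductSpace ℂ H]

/-- The vectors `x` for which `(T - z) f(z) = x` has an analytic solution on all of `U`. -/
def analyticSolvableSubmodule (T : H →L[ℂ] H) (U : Set ℂ) : Submodule ℂ H where
  carrier := {x | ∃ f : ℂ → H, AnalyticOnNhd ℂ f U ∧ ∀ z ∈ U, T (f z) - z • f z = x}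
  zero_mem' := ⟨fun _ => 0, analyticOnNhd_const, fun z _ => by simp⟩
  add_mem' := by
    rintro x y ⟨f, hf, hfx⟩ ⟨g, hg, hgy⟩
    refine ⟨fun z => f z + g z, hf.add hg, fun z hz => ?_⟩
    rw [← hfx z hz, ← hgy z hz, map_add, smul_add]
    abel
  smul_mem' := by
    rintro c x ⟨f, hf, hfx⟩
    refine ⟨fun z => c • f z, fun z hz => analyticAt_const.smul (hf z hz), fun z hz => ?_⟩
    rw [← hfx z hz, map_smul, smul_sub, smul_comm]

/-- `T` commutes with `T - z`, so `T ∘ f` solves the new equation. -/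
theorem map_mem_analyticSolvableSubmodule {T : H →L[ℂ] H} {U : Set ℂ} {x : H}
    (hx : x ∈ analyticSolvableSubmodule T U) : T x ∈ analyticSolvableSubmodule T U := by
  obtain ⟨f, hf, hfx⟩ := hx
  refine ⟨fun z => T (f z), fun z hz => (T.analyticAt _).comp (hf z hz), fun z hz => ?_⟩
  rw [← hfx z hz, map_sub, map_smul]

theorem localSpectrum_subset_compl_of_mem {T : H →L[ℂ] H} {U : Set ℂ} (hU : IsOpen U) {x : H}
    (hx : x ∈ analyticSolvableSubmodule T U) : localSpectrum T x ⊆ Uᶜ :=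
  Set.compl_subset_compl.mpr fun _ hz => ⟨U, ⟨hU, hx⟩, hz⟩

theorem exists_apply_sub_smul_eq_of_notMem_localSpectrum {T : H →L[ℂ] H} {x : H} {z : ℂ}
    (hz : z ∉ localSpectrum T x) : ∃ y, T y - z • y = x := by
  obtain ⟨U, ⟨-, f, -, hf⟩, hzU⟩ := Set.notMem_compl_iff.mp hz
  exact ⟨f z, hf z hzU⟩

theorem isOpen_setOf_lt_enorm (r : ENNReal) : IsOpen {z : ℂ | r < ‖z‖ₑ} :=
  isOpen_lt continuous_const continuous_enorm

/-- If `ρ⁻ⁿ ‖Tⁿ x‖` is summable for every finite `ρ > r`, the Neumann series solves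
`(T - z) f(z) = x` outside the disc of radius `r`. -/
theorem mem_analyticSolvableSubmodule_of_summable [CompleteSpace H] {T : H →L[ℂ] H} {x : H}
    {r : ENNReal}
    (hr : ∀ ρ : ℝ, r < ENNReal.ofReal ρ → Summable fun n : ℕ => ρ⁻¹ ^ n * ‖(T ^ n) x‖) :
    x ∈ analyticSolvableSubmodule T {z | r < ‖z‖ₑ} := by
  have key : ∀ z : ℂ, r < ‖z‖ₑ → Summable fun n : ℕ => z⁻¹ ^ n • (T ^ n) x := by
    intro z hz
    refine Summable.of_norm ?_
    simpa [norm_smul] using hr ‖z‖ (by rwa [ofReal_norm])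
  refine ⟨fun z => -(z⁻¹ • ∑' n : ℕ, z⁻¹ ^ n • (T ^ n) x), ?_, ?_⟩
  · refine DifferentiableOn.analyticOnNhd (fun z hz => ?_) (isOpen_setOf_lt_enorm r)
    have hz0 : z ≠ 0 := by
      rintro rfl
      simp at hz
    -- A radius `q` strictly between `r` and `‖z‖` gives one summable majorant near `z`, so the
    -- series is differentiable there.
    obtain ⟨q, hrq, hqz⟩ := ENNReal.lt_iff_exists_nnreal_btwn.mp (show r < ‖z‖ₑ from hz)
    have hq0 : (0 : ℝ) < q := by
      have : (0 : ENNReal) < q := zero_le.trans_lt hrq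
      exact_mod_cast this
    have hsum : Summable fun n : ℕ => (q : ℝ)⁻¹ ^ n * ‖(T ^ n) x‖ :=
      hr q (by simpa using hrq)
    have hd := Complex.differentiableOn_tsum_of_summable_norm
      (F := fun (n : ℕ) (w : ℂ) => w⁻¹ ^ n • (T ^ n) x) hsum
      (U := {w : ℂ | (q : ENNReal) < ‖w‖ₑ}) (fun n w hw => ?_)
      (isOpen_setOf_lt_enorm _) (fun n w hw => ?_)
    · have h1 := hd.differentiableAt ((isOpen_setOf_lt_enorm (q : ENNReal)).mem_nhds hqz)
      exact (((differentiableAt_id.inv hz0).smul h1).neg).differentiableWithinAt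
    · have hw0 : w ≠ 0 := by
        rintro rfl
        simp at hw
      exact (((differentiableAt_id.inv hw0).pow n).smul_const _).differentiableWithinAt
    · have hqw : (q : ℝ) ≤ ‖w‖ := by
        have h2 : (q : ENNReal) < (‖w‖₊ : ENNReal) := hw
        exact_mod_cast h2.le
      simp only [norm_smul, norm_pow, norm_inv]
      gcongr
  · intro z hz
    have hz0 : z ≠ 0 := by
      rintro rfl
      simp at hz
    have hs := key z hz
    have h1 := hs.tsum_eq_zero_add
    have h2 : z⁻¹ • T (∑' n : ℕ, z⁻¹ ^ n • (T ^ n) x)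
        = ∑' n : ℕ, z⁻¹ ^ (n + 1) • (T ^ (n + 1)) x := by
      rw [T.map_tsum hs, ← tsum_const_smul'']
      congr 1
      ext n
      rw [map_smul, smul_smul, ← pow_succ', pow_succ' T n]
      rfl
    rw [map_neg, map_smul, h2, smul_neg, smul_smul, mul_inv_cancel₀ hz0, one_smul, h1]
    simp

end LocalResolvent

theorem weightProd_pos {ω : ℕ → ℝ} (hω : ∀ n, 0 < ω n) (n : ℕ) : 0 < weightProd ω n :=
  Finset.prod_pos fun i _ => hω i

/-- For `q` strictly between `r₃` and `ρ`, eventually `βₙ ≤ qⁿ`, so a geometric series of ratio `q /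
ρ` dominates. -/
theorem summable_inv_pow_mul_weightProd {ω : ℕ → ℝ} (hω : ∀ n, 0 < ω n) {ρ : ℝ}
    (hρ : shiftR3 ω < ENNReal.ofReal ρ) : Summable fun n : ℕ => ρ⁻¹ ^ n * weightProd ω n := by
  have hρ0 : 0 < ρ := ENNReal.ofReal_pos.mp (zero_le.trans_lt hρ)
  obtain ⟨q, hq, hqρ⟩ := ENNReal.lt_iff_exists_nnreal_btwn.mp hρ
  have hqρ' : (q : ℝ) < ρ := by
    rwa [← ENNReal.ofReal_coe_nnreal, ENNReal.ofReal_lt_ofReal_iff hρ0] at hqρ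
  refine Summable.of_norm_bounded_eventually_nat (g := fun n : ℕ => (ρ⁻¹ * q) ^ n)
    (summable_geometric_of_lt_one (by positivity) ?_) ?_
  · rw [inv_mul_lt_iff₀ hρ0]
    simpa using hqρ'
  · filter_upwards [eventually_lt_of_limsup_lt hq, eventually_gt_atTop 0] with n hn hn0
    have hβ := weightProd_pos hω n
    have h1 : weightProd ω n ^ (1 / (n : ℝ)) ≤ q := by
      rw [← ENNReal.ofReal_coe_nnreal] at hn
      exact ENNReal.ofReal_le_ofReal_iff q.2 |>.mp hn.le
    have h2 : weightProd ω n ≤ (q : ℝ) ^ n := by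
      rw [one_div] at h1
      calc weightProd ω n = (weightProd ω n ^ ((n : ℝ)⁻¹)) ^ n :=
            (Real.rpow_inv_natCast_pow hβ.le hn0.ne').symm
        _ ≤ (q : ℝ) ^ n := by gcongr
    rw [Real.norm_of_nonneg (by positivity), mul_pow]
    gcongr

namespace IsUnilateralWeightedShift

variable {H : Type*} [NormedAddCommGroup H] [InnerProductSpace ℂ H]
  {e : HilbertBasis ℕ ℂ H} {ω : ℕ → ℝ} {S : H →L[ℂ] H}

theorem pow_apply_zero (hS : IsUnilateralWeightedShift e ω S) (n : ℕ) :
    (S ^ n) (e 0) = (weightProd ω n : ℂ) • e n := by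
  induction n with
  | zero => simp [weightProd]
  | succ n ih =>
    rw [pow_succ', mul_apply_eq_comp, ih, map_smul, hS.apply_basis, smul_smul,
      weightProd, weightProd, Finset.prod_range_succ]
    push_cast
    rfl

theorem norm_pow_apply_zero (hS : IsUnilateralWeightedShift e ω S) (n : ℕ) :
    ‖(S ^ n) (e 0)‖ = weightProd ω n := by
  rw [hS.pow_apply_zero, norm_smul, e.orthonormal.1, mul_one, Complex.norm_real,
    Real.norm_of_nonneg (weightProd_pos hS.weight_pos n).le]

theorem hasSum_inner_apply (hS : IsUnilateralWeightedShift e ω S) (x : H) (m : ℕ) :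
    HasSum (fun n => e.repr x n * (ω n * if m = n + 1 then 1 else 0)) (inner ℂ (e m) (S x)) := by
  have h := (e.hasSum_repr x).mapL ((innerSL ℂ (e m)).comp S)
  simpa [hS.apply_basis, inner_smul_right, orthonormal_iff_ite.mp e.orthonormal] using h

theorem inner_zero_apply (hS : IsUnilateralWeightedShift e ω S) (x : H) :
    inner ℂ (e 0) (S x) = 0 :=
  (hS.hasSum_inner_apply x 0).unique (by simp)

theorem inner_succ_apply (hS : IsUnilateralWeightedShift e ω S) (x : H) (m : ℕ) :
    inner ℂ (e (m + 1)) (S x) = ω m * inner ℂ (e m) x := by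
  refine (hS.hasSum_inner_apply x (m + 1)).unique ?_
  convert hasSum_single m ?_ using 1
  · simp [e.repr_apply_apply, mul_comm]
  · intro n hn
    simp [hn.symm]

/-- Comparing coordinates gives `z x₀ = 0` and `z xₘ₊₁ = ωₘ xₘ`, so all coordinates vanish in turn.
-/
theorem eq_zero_of_apply_eq_smul (hS : IsUnilateralWeightedShift e ω S) {z : ℂ} (hz : z ≠ 0)
    {x : H} (hx : S x = z • x) : x = 0 := by
  have hcoeff : ∀ n, inner ℂ (e n) x = 0 := by
    intro n
    have h : z * inner ℂ (e n) x = 0 := by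
      rw [← inner_smul_right, ← hx]
      induction n with
      | zero => exact hS.inner_zero_apply x
      | succ n ih =>
        rw [hx, inner_smul_right] at ih
        rw [hS.inner_succ_apply, (mul_eq_zero.mp ih).resolve_left hz, mul_zero]
    exact (mul_eq_zero.mp h).resolve_left hz
  refine e.repr.map_eq_zero_iff.mp ?_
  ext n
  simpa [e.repr_apply_apply] using hcoeff n

theorem basis_mem_analyticSolvableSubmodule [CompleteSpace H]
    (hS : IsUnilateralWeightedShift e ω S) (n : ℕ) :
    e n ∈ analyticSolvableSubmodule S {z | shiftR3 ω < ‖z‖ₑ} := by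
  induction n with
  | zero =>
    refine mem_analyticSolvableSubmodule_of_summable fun ρ hρ => ?_
    simpa only [hS.norm_pow_apply_zero] using summable_inv_pow_mul_weightProd hS.weight_pos hρ
  | succ n ih =>
    have h := Submodule.smul_mem _ (ω n : ℂ)⁻¹ (map_mem_analyticSolvableSubmodule ih)
    rwa [hS.apply_basis, inv_smul_smul₀ (by exact_mod_cast (hS.weight_pos n).ne')] at h

theorem mem_analyticSpectralSubspace [CompleteSpace H] (hS : IsUnilateralWeightedShift e ω S)
    (hC : DunfordConditionC S) (x : H) :
    x ∈ analyticSpectralSubspace S {z | shiftR3 ω < ‖z‖ₑ}ᶜ := by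
  have hU := isOpen_setOf_lt_enorm (shiftR3 ω)
  -- One common open set for all `eₙ` makes sums solvable without gluing local solutions.
  have hspan : Submodule.span ℂ (Set.range e) ≤
      analyticSolvableSubmodule S {z | shiftR3 ω < ‖z‖ₑ} :=
    Submodule.span_le.mpr (Set.range_subset_iff.mpr hS.basis_mem_analyticSolvableSubmodule)
  have hx : x ∈ closure (Submodule.span ℂ (Set.range e) : Set H) := by
    rw [← Submodule.topologicalClosure_coe, e.dense_span]
    trivial
  exact closure_minimal (fun y hy => localSpectrum_subset_compl_of_mem hU (hspan hy))
    (hC _ hU.isClosed_compl) hx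

theorem spectralRadius_le [CompleteSpace H] (hS : IsUnilateralWeightedShift e ω S)
    (hC : DunfordConditionC S) : spectralRadius ℂ S ≤ shiftR3 ω := by
  refine iSup₂_le fun z hz => ?_
  by_contra! hlt
  have hz0 : z ≠ 0 := by
    rintro rfl
    simp at hlt
  refine hz ?_
  -- By the open mapping theorem, bijectivity suffices for invertibility.
  rw [spectrum.mem_resolventSet_iff, ← neg_sub, IsUnit.neg_iff,
    ContinuousLinearMap.isUnit_iff_bijective]
  have happ : ∀ y, (S - algebraMap ℂ (H →L[ℂ] H) z) y = S y - z • y := fun y => rfl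
  refine ⟨(injective_iff_map_eq_zero _).mpr fun y hy => ?_, fun x => ?_⟩
  · exact hS.eq_zero_of_apply_eq_smul hz0 (sub_eq_zero.mp ((happ y).symm.trans hy))
  · exact exists_apply_sub_smul_eq_of_notMem_localSpectrum
      fun h => hS.mem_analyticSpectralSubspace hC x h hlt

theorem shiftR3_le_spectralRadius [CompleteSpace H] (hS : IsUnilateralWeightedShift e ω S) :
    shiftR3 ω ≤ spectralRadius ℂ S := by
  refine le_trans (limsup_le_limsup (Eventually.of_forall fun n => ?_))
    (spectrum.limsup_pow_nnnorm_pow_one_div_le_spectralRadius S)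
  have hle : weightProd ω n ≤ ‖S ^ n‖ := by
    have h := (S ^ n).le_opNorm (e 0)
    rwa [hS.norm_pow_apply_zero, e.orthonormal.1, mul_one] at h
  have hβ := weightProd_pos hS.weight_pos n
  have hcoe : ((‖S ^ n‖₊ : ENNReal)) = ENNReal.ofReal ‖S ^ n‖ := (ofReal_norm _).symm
  dsimp only
  rw [hcoe, ENNReal.ofReal_rpow_of_nonneg (norm_nonneg _) (by positivity)]
  gcongr

end IsUnilateralWeightedShift

theorem theorem3 {H : Type*} [NormedAddCommGroup H] [InnerProductSpace ℂ H] [CompleteSpace H]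
    (e : HilbertBasis ℕ ℂ H) (ω : ℕ → ℝ) (S : H →L[ℂ] H)
    (hS : IsUnilateralWeightedShift e ω S) (hC : DunfordConditionC S) :
    spectralRadius ℂ S = shiftR3 ω :=
  le_antisymm (hS.spectralRadius_le hC) hS.shiftR3_le_spectralRadius
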